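/- A simple partial fraction (SPF) of order $n\in\mathbb N$ is a rational function $$\rho_n(z)=\sum_{k=1}^m\frac{n_k}{z-\xi_k},$$ where $\xi_1,\dots,\xi_m\in\mathbb C$ are pairwise distinct, $n_1,\dots,n_m$ are positive integers and $n_1+\dots+n_m=n$. (Equivalently, $\rho_n$ is the logarithmic derivative of a monic polynomial of degree $n$.) No restriction is imposed on the location of the poles $\xi_k$. Put $Y(\rho_n)=\min_{1\le k\le m}|\operatorname{Im}\xi_k|$ and $$d'_n(\mathbb R,\infty)=\inf\{Y(\rho_n):\ \rho_n\ \text{is an SPF of order } n,\ \|\rho_n'\|_{L^\infty(\mathbb R)}\le 1\}.$$ Theorem. There exist an absolute constant $c>0$ and an absolute $n_0\in\mathbb N$ such that $$d'_n(\mathbb R,\infty)\ge c\,\sqrt{\frac{\ln n}{n}}\qquad\text{for all } n\ge n_0.$$ That is, for $n\ge n_0$ every SPF $\rho_n$ of order $n$ with $\|\rho_n'\|_{L^\infty(\mathbb R)}\le 1$ has all its poles at distance at least $c\sqrt{\ln n/n}$ from the real axis. -/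

import Mathlib

open MeasureTheory
open scoped ENNReal

/-- A simple partial fraction of order `n`: pairwise distinct poles `ξ₁, …, ξₘ ∈ ℂ` (no
restriction on their location) with positive integer multiplicities `n₁ + ⋯ + nₘ = n`. -/
structure SimplePartialFraction (n : ℕ) where
  /-- the number `m` of distinct poles -/
  numPoles : ℕ
  /-- the poles `ξ₁, …, ξₘ` -/
  pole : Fin numPoles → ℂ
  /-- the multiplicities (residues) `n₁, …, nₘ` -/
  mult : Fin numPoles → ℕ
  pole_injective : Function.Injective pole
  mult_pos : ∀ k, 0 < mult k
  sum_mult : ∑ k, mult k = n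

namespace SimplePartialFraction

/-- The function `ρ(z) = ∑ₖ nₖ / (z - ξₖ)`. -/
noncomputable def eval {n : ℕ} (ρ : SimplePartialFraction n) (z : ℂ) : ℂ :=
  ∑ k, (ρ.mult k : ℂ) / (z - ρ.pole k)

/-- `Y(ρ) = minₖ |Im ξₖ|`, the distance from the poles of `ρ` to the real axis
(a minimum over a nonempty finite set as soon as `n ≥ 1`). -/
noncomputable def minAbsIm {n : ℕ} (ρ : SimplePartialFraction n) : ℝ :=
  ⨅ k, |(ρ.pole k).im|

/-- `‖ρ'‖_{L^p(ℝ)}`, with values in `[0, ∞]`. -/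
noncomputable def derivNorm {n : ℕ} (ρ : SimplePartialFraction n) (p : ℝ≥0∞) : ℝ≥0∞ :=
  eLpNorm (fun x : ℝ => deriv ρ.eval (x : ℂ)) p volume

end SimplePartialFraction

/-- `d'ₙ(ℝ, p) = inf {Y(ρ) : ρ a simple partial fraction of order n, ‖ρ'‖_{L^p(ℝ)} ≤ 1}`. -/
noncomputable def gelfondInf (n : ℕ) (p : ℝ≥0∞) : ℝ :=
  sInf {y : ℝ | ∃ ρ : SimplePartialFraction n, ρ.derivNorm p ≤ 1 ∧ ρ.minAbsIm = y}

/-! Let `Q` be the monic polynomial with `Q'/Q = ρ`, translate so that the pole studied is `iy`, and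
put `a = ρ(0)`. Since `|ρ'| ≤ 1` on the real line, `|ρ(x) - a| ≤ |x|`, so `F(z) = Q(z) e^{-az}`
satisfies `|F(x)| ≤ |F(0)| e^{x²}`; moreover `F'(0) = 0` and `F'' = (ρ' + (ρ - a)²) F`, whence
`|F''(x)| ≤ |F(0)| e^{2x²}`.

The degree enters twice. It forces `|a| ≤ 8√n` (`norm_fractionSum_zero_le`): otherwise the argument
or the modulus of `Q` would vary more than degree `n` allows. It also bounds `F''` on the disc of
radius `√n` by `|F(0)| e^{21n}` (`Polynomial.norm_eval_le_of_forall_mem_Icc`). A two-constants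
argument (`norm_mul_I_le_of_norm_le_on_disc`) turns these bounds into `|F''(it)| ≤ |F(0)|
e^{42√n|t|}`.

Integrating twice from `0` to the zero `iy` of `F` gives `1 ≤ y² e^{42√n|y|}`
(`one_le_sq_mul_exp_of_pole`), which fails if `|y|` is below `√(ln n / n) / 42`. -/

/-! ### Growth of polynomials off an interval. -/

theorem prod_range_erase_abs_sub_eq_factorial_mul_factorial {n j : ℕ} (hj : j ≤ n) :
    ∏ i ∈ (Finset.range (n + 1)).erase j, |(j : ℝ) - i| = (j.factorial : ℝ) * (n - j).factorial := by
  induction n, hj using Nat.le_induction with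
  | base =>
    have h : (Finset.range (j + 1)).erase j = Finset.range j := by
      ext i; simp only [Finset.mem_erase, Finset.mem_range]; omega
    rw [h, ← Finset.prod_range_reflect, Nat.sub_self, Nat.factorial_zero,
      ← Finset.prod_range_add_one_eq_factorial]
    push_cast
    rw [mul_one]
    refine Finset.prod_congr rfl fun i hi => ?_
    have hi' := Finset.mem_range.1 hi
    have : ((j - 1 - i : ℕ) : ℝ) = j - 1 - i := by
      rw [Nat.cast_sub (by omega), Nat.cast_sub (by omega)]; simp
    rw [this, abs_of_nonneg] <;> linarith [(Nat.cast_nonneg i : (0 : ℝ) ≤ i)]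
  | succ n hn ih =>
    have h : (Finset.range (n + 1 + 1)).erase j = insert (n + 1) ((Finset.range (n + 1)).erase j) := by
      ext i; simp only [Finset.mem_erase, Finset.mem_range, Finset.mem_insert]; omega
    rw [h, Finset.prod_insert (by simp), ih, Nat.succ_sub hn, Nat.factorial_succ]
    have hc : (j : ℝ) ≤ n := by exact_mod_cast hn
    push_cast [Nat.cast_sub hn]
    rw [abs_of_nonpos (by linarith)]
    ring

/-- A polynomial of degree at most `n` bounded by `M` on a real interval of length `ℓ` is bounded by
`12 ^ n * M` at every point whose distance to the points of the interval is at most `2 * ℓ`. -/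
theorem Polynomial.norm_eval_le_of_forall_mem_Icc {n : ℕ} (hn : 1 ≤ n) {P : Polynomial ℂ}
    (hP : P.natDegree ≤ n) {α ℓ M : ℝ} (hℓ : 0 < ℓ)
    (hM : ∀ x ∈ Set.Icc α (α + ℓ), ‖P.eval (x : ℂ)‖ ≤ M) {z : ℂ}
    (hz : ∀ x ∈ Set.Icc α (α + ℓ), ‖z - x‖ ≤ 2 * ℓ) : ‖P.eval z‖ ≤ M * 12 ^ n := by
  have hn0 : (0 : ℝ) < n := by exact_mod_cast hn
  have hM0 : 0 ≤ M := (norm_nonneg _).trans (hM α ⟨le_rfl, by linarith⟩)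
  set h : ℝ := ℓ / n with hh
  have hh0 : 0 < h := by positivity
  -- Lagrange interpolation at `n + 1` equally spaced nodes of step `ℓ / n`.
  set s := Finset.range (n + 1) with hs
  set t : ℕ → ℝ := fun j => α + j * h with ht
  have htI : ∀ j ∈ s, t j ∈ Set.Icc α (α + ℓ) := by
    intro j hj
    have hj' : (j : ℝ) ≤ n := by
      exact_mod_cast Nat.lt_succ_iff.1 (Finset.mem_range.1 hj)
    refine ⟨by simp only [ht]; nlinarith [(Nat.cast_nonneg j : (0 : ℝ) ≤ j)], ?_⟩
    have : (n : ℝ) * h = ℓ := by rw [hh]; field_simp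
    simp only [ht]; nlinarith
  have hinj : Set.InjOn (fun j => (t j : ℂ)) s := by
    intro i _ j _ hij
    have : t i = t j := Complex.ofReal_injective hij
    simp only [ht] at this
    have : (i : ℝ) = j := mul_right_cancel₀ hh0.ne' (by linarith)
    exact_mod_cast this
  have hdeg : P.degree < s.card := by
    rw [hs, Finset.card_range]
    exact lt_of_le_of_lt Polynomial.degree_le_natDegree (by exact_mod_cast Nat.lt_succ_of_le hP)
  have key : P.eval z = ∑ j ∈ s, P.eval (t j : ℂ) *
      ∏ i ∈ s.erase j, (((t j : ℂ) - t i)⁻¹ * (z - t i)) := by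
    conv_lhs => rw [Lagrange.eq_interpolate hinj hdeg]
    simp [Lagrange.interpolate_apply, Polynomial.eval_finsetSum, Lagrange.basis,
      Polynomial.eval_prod, Lagrange.basisDivisor]
  have hterm : ∀ j ∈ s, ‖P.eval (t j : ℂ) * ∏ i ∈ s.erase j, (((t j : ℂ) - t i)⁻¹ * (z - t i))‖
      ≤ M * ((2 * n) ^ n / (n.factorial : ℝ) * n.choose j) := by
    intro j hj
    have hjn : j ≤ n := Nat.lt_succ_iff.1 (Finset.mem_range.1 hj)
    rw [norm_mul]
    refine mul_le_mul (hM _ (htI j hj)) ?_ (norm_nonneg _) hM0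
    rw [norm_prod]
    calc ∏ i ∈ s.erase j, ‖((t j : ℂ) - t i)⁻¹ * (z - t i)‖
        ≤ ∏ i ∈ s.erase j, (2 * n * |(j : ℝ) - i|⁻¹) := by
          refine Finset.prod_le_prod (fun _ _ => norm_nonneg _) fun i hi => ?_
          have hi' := Finset.mem_erase.1 hi
          have hne : (0 : ℝ) < |(j : ℝ) - i| := by
            rw [abs_pos, sub_ne_zero]; exact_mod_cast hi'.1.symm
          have h1 : ‖(t j : ℂ) - t i‖ = |(j : ℝ) - i| * h := by
            rw [← Complex.ofReal_sub, Complex.norm_real, Real.norm_eq_abs]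
            have : t j - t i = (j - i) * h := by simp only [ht]; ring
            rw [this, abs_mul, abs_of_pos hh0]
          rw [norm_mul, norm_inv, h1]
          calc (|(j : ℝ) - i| * h)⁻¹ * ‖z - t i‖ ≤ (|(j : ℝ) - i| * h)⁻¹ * (2 * ℓ) := by
                gcongr; exact hz _ (htI i hi'.2)
            _ = _ := by rw [hh]; field_simp
      _ = (2 * n) ^ n * ((j.factorial : ℝ) * (n - j).factorial)⁻¹ := by
          rw [Finset.prod_mul_distrib, Finset.prod_const, Finset.card_erase_of_mem hj,
            Finset.prod_inv_distrib, hs, prod_range_erase_abs_sub_eq_factorial_mul_factorial hjn]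
          simp
      _ = _ := by
          rw [Nat.cast_choose ℝ hjn]
          have := n.factorial_ne_zero
          field_simp
  calc ‖P.eval z‖ ≤ ∑ j ∈ s, M * ((2 * n) ^ n / (n.factorial : ℝ) * n.choose j) := by
        rw [key]; exact norm_sum_le_of_le _ hterm
    _ = M * (4 ^ n * ((n : ℝ) ^ n / n.factorial)) := by
        rw [← Finset.mul_sum, ← Finset.mul_sum]
        have : ∑ j ∈ s, (n.choose j : ℝ) = 2 ^ n := by exact_mod_cast Nat.sum_range_choose n
        rw [this, mul_pow, show (4 : ℝ) = 2 * 2 by norm_num, mul_pow]; ring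
    -- `n ^ n / n!` is one term of the series of `e ^ n`, and `e < 3`.
    _ ≤ M * (4 ^ n * 3 ^ n) := by
        gcongr
        refine (Real.pow_div_factorial_le_exp (n : ℝ) hn0.le n).trans ?_
        rw [← mul_one (n : ℝ), Real.exp_nat_mul]
        gcongr
        linarith [Real.exp_one_lt_d9]
    _ = M * 12 ^ n := by rw [← mul_pow]; norm_num

/-! ### Two-constants estimate. -/

/-- A two-constants type estimate in a half-disc, on the positive imaginary axis. -/
theorem norm_mul_I_le_of_norm_le_on_disc_of_nonneg {H : ℂ → ℂ} (hH : Differentiable ℂ H)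
    {R B M : ℝ} (hB : 2 ≤ B) (hM : 0 ≤ M)
    (hreal : ∀ x : ℝ, |x| ≤ R → ‖H x‖ ≤ M * Real.exp (2 * x ^ 2))
    (hdisc : ∀ z : ℂ, ‖z‖ ≤ R → ‖H z‖ ≤ M * Real.exp (B * R ^ 2))
    {y : ℝ} (hy0 : 0 ≤ y) (hy : y ≤ R) : ‖H (y * Complex.I)‖ ≤ M * Real.exp (2 * B * R * y) := by
  have hR : 0 ≤ R := hy0.trans hy
  -- On the real axis the factor has modulus `e^{-Bx²}`, which absorbs `e^{2x²}` as `B ≥ 2`. On the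
  -- arc it cancels `e^{BR²}` and leaves `e^{2B y(y-R)} ≤ 1`, where `y = Im z`. Thus `|G| ≤ M` on
  -- the whole boundary of the half-disc.
  set G : ℂ → ℂ := fun z => H z * Complex.exp (-B * z ^ 2 + 2 * B * R * Complex.I * z) with hG
  have hGn : ∀ z : ℂ, ‖G z‖ = ‖H z‖ * Real.exp (-B * (z.re ^ 2 - z.im ^ 2) - 2 * B * R * z.im) := by
    intro z
    rw [hG]
    simp only [norm_mul, Complex.norm_exp]
    congr 2
    simp [pow_two]
    ring
  set U : Set ℂ := Metric.ball 0 R ∩ {z | 0 < z.im} with hU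
  have hGd : Differentiable ℂ G := by
    rw [hG]; fun_prop
  have hfr : ∀ z ∈ frontier U, ‖G z‖ ≤ M := by
    intro z hz
    have h1 : ‖z‖ ≤ R ∧ z.im = 0 ∨ ‖z‖ = R ∧ 0 ≤ z.im := by
      rcases frontier_inter_subset _ _ hz with ⟨h1, h2⟩ | ⟨h1, h2⟩
      · right
        constructor
        · have := Metric.frontier_ball_subset_sphere h1
          simpa using this
        · rw [Complex.closure_setOfPred_lt_im] at h2; exact h2
      · left
        constructor
        · have := Metric.closure_ball_subset_closedBall h1
          simpa using this
        · rw [Complex.frontier_setOfPred_lt_im] at h2; exact h2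
    rw [hGn]
    rcases h1 with ⟨h1, h2⟩ | ⟨h1, h2⟩
    · have hzr : z = (z.re : ℂ) := by apply Complex.ext <;> simp [h2]
      have hb : |z.re| ≤ R := (Complex.abs_re_le_norm z).trans h1
      have := hreal z.re hb
      rw [← hzr] at this
      calc _ ≤ M * Real.exp (2 * z.re ^ 2) *
            Real.exp (-B * (z.re ^ 2 - z.im ^ 2) - 2 * B * R * z.im) := by gcongr
        _ = M * Real.exp ((2 - B) * z.re ^ 2) := by
          rw [mul_assoc, ← Real.exp_add, h2]; ring_nf
        _ ≤ M * 1 := by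
          gcongr
          rw [Real.exp_le_one_iff]
          nlinarith [sq_nonneg z.re]
        _ = M := mul_one M
    · have hsq : z.re ^ 2 + z.im ^ 2 = R ^ 2 := by
        rw [← h1, ← Complex.normSq_eq_norm_sq, Complex.normSq_apply]; ring
      have him : z.im ≤ R := by
        rw [← h1]; exact (le_abs_self _).trans (Complex.abs_im_le_norm z)
      calc _ ≤ M * Real.exp (B * R ^ 2) *
            Real.exp (-B * (z.re ^ 2 - z.im ^ 2) - 2 * B * R * z.im) := by
            gcongr; exact hdisc z h1.le
        _ = M * Real.exp (2 * B * (z.im * (z.im - R))) := by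
          rw [mul_assoc, ← Real.exp_add]
          congr 2
          linear_combination -B * hsq
        _ ≤ M * 1 := by
          gcongr
          rw [Real.exp_le_one_iff]
          have : z.im * (z.im - R) ≤ 0 := mul_nonpos_of_nonneg_of_nonpos h2 (by linarith)
          nlinarith
        _ = M := mul_one M
  by_cases hyR : y = R
  · calc _ ≤ M * Real.exp (B * R ^ 2) := hdisc _ (by simp [abs_of_nonneg hy0, hy])
      _ ≤ _ := by
        refine mul_le_mul_of_nonneg_left (Real.exp_le_exp.2 ?_) hM
        rw [hyR]
        nlinarith [sq_nonneg R]
  by_cases hy00 : y = 0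
  · simpa [hy00] using hreal 0 (by simpa using hR)
  have hmem : (y * Complex.I) ∈ closure U := by
    refine subset_closure ⟨?_, ?_⟩
    · simpa [abs_of_nonneg hy0] using lt_of_le_of_ne hy hyR
    · simpa using lt_of_le_of_ne hy0 (Ne.symm hy00)
  have := Complex.norm_le_of_forall_mem_frontier_norm_le
    (Metric.isBounded_ball.subset Set.inter_subset_left) hGd.diffContOnCl hfr hmem
  rw [hGn] at this
  simp only [Complex.mul_re, Complex.ofReal_re, Complex.I_re, mul_zero, Complex.ofReal_im,
    Complex.I_im, mul_one, sub_self, Complex.mul_im, add_zero] at this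
  calc ‖H (y * Complex.I)‖
      = ‖H (y * Complex.I)‖ * Real.exp (-B * (0 ^ 2 - y ^ 2) - 2 * B * R * y) *
        Real.exp (-B * y ^ 2 + 2 * B * R * y) := by
        rw [mul_assoc, ← Real.exp_add]; ring_nf; simp
    _ ≤ M * Real.exp (-B * y ^ 2 + 2 * B * R * y) := by gcongr
    _ ≤ _ := by
        gcongr
        nlinarith [sq_nonneg y]

theorem norm_mul_I_le_of_norm_le_on_disc {H : ℂ → ℂ} (hH : Differentiable ℂ H)
    {R B M : ℝ} (hB : 2 ≤ B) (hM : 0 ≤ M)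
    (hreal : ∀ x : ℝ, |x| ≤ R → ‖H x‖ ≤ M * Real.exp (2 * x ^ 2))
    (hdisc : ∀ z : ℂ, ‖z‖ ≤ R → ‖H z‖ ≤ M * Real.exp (B * R ^ 2))
    {y : ℝ} (hy : |y| ≤ R) : ‖H (y * Complex.I)‖ ≤ M * Real.exp (2 * B * R * |y|) := by
  rcases le_total 0 y with h | h
  · rw [abs_of_nonneg h] at hy ⊢
    exact norm_mul_I_le_of_norm_le_on_disc_of_nonneg hH hB hM hreal hdisc h hy
  · rw [abs_of_nonpos h] at hy ⊢
    have := norm_mul_I_le_of_norm_le_on_disc_of_nonneg (H := fun z => H (-z)) (by fun_prop) hB hM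
      (fun x hx => by simpa using hreal (-x) (by simpa using hx))
      (fun z hz => hdisc (-z) (by simpa using hz)) (neg_nonneg.2 h) hy
    simpa using this

/-! ### Calculus on the real line. -/

theorem abs_sub_le_sq_of_abs_deriv_le {f f' : ℝ → ℝ} (hf : ∀ x, HasDerivAt f (f' x) x)
    (hb : ∀ x, |f' x| ≤ |x|) (x : ℝ) : |f x - f 0| ≤ x ^ 2 := by
  have h := (convex_Icc (-|x|) |x|).norm_image_sub_le_of_norm_hasDerivWithin_le
    (fun t _ => (hf t).hasDerivWithinAt)
    (fun t ht => (Real.norm_eq_abs _).le.trans ((hb t).trans (abs_le.2 ht)))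
    (x := 0) (y := x) (Set.mem_Icc.2 (by simp)) (Set.mem_Icc.2 (abs_le.1 le_rfl))
  simpa [← pow_two] using h

theorem hasDerivAt_log_norm {F : ℝ → ℂ} {w : ℂ} {x : ℝ} (hF : HasDerivAt F (w * F x) x)
    (h0 : F x ≠ 0) : HasDerivAt (fun t => Real.log ‖F t‖) w.re x := by
  have h1 := (hF.norm_sq.log (by positivity)).const_mul (1 / 2 : ℝ)
  have h2 : ∀ t, 1 / 2 * Real.log (‖F t‖ ^ 2) = Real.log ‖F t‖ := fun t => by
    rw [Real.log_pow]; push_cast; ring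
  simp only [h2] at h1
  refine h1.congr_deriv ?_
  have : inner ℝ (F x) (w * F x) = w.re * ‖F x‖ ^ 2 := by
    rw [Complex.inner, ← Complex.normSq_eq_norm_sq, Complex.normSq_apply]
    simp; ring
  rw [this]
  have := norm_pos_iff.2 h0
  field_simp

/-! ### Simple fractions as logarithmic derivatives. -/

section PoleSums

variable {ι : Type*} [Fintype ι] (ξ : ι → ℂ) (m : ι → ℕ)

/-- The sum of simple fractions `∑ₖ mₖ / (z - ξₖ)`. -/
noncomputable def fractionSum (z : ℂ) : ℂ := ∑ k, (m k : ℂ) / (z - ξ k)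

/-- The derivative `-∑ₖ mₖ / (z - ξₖ)²` of `fractionSum`. -/
noncomputable def fractionSumDeriv (z : ℂ) : ℂ := -∑ k, (m k : ℂ) / (z - ξ k) ^ 2

/-- The polynomial `∏ₖ (X - ξₖ) ^ mₖ` whose logarithmic derivative is `fractionSum`. -/
noncomputable def polePolynomial : Polynomial ℂ := ∏ k, (Polynomial.X - Polynomial.C (ξ k)) ^ m k

variable {ξ m}

theorem hasDerivAt_fractionSum {z : ℂ} (hz : ∀ k, z ≠ ξ k) :
    HasDerivAt (fractionSum ξ m) (fractionSumDeriv ξ m z) z := by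
  unfold fractionSum fractionSumDeriv
  rw [← Finset.sum_neg_distrib]
  refine HasDerivAt.fun_sum fun k _ => ?_
  have := (((hasDerivAt_id z).sub_const (ξ k)).fun_inv (sub_ne_zero.2 (hz k))).const_mul (m k : ℂ)
  refine this.congr_deriv ?_
  simp [div_eq_mul_inv]

theorem natDegree_polePolynomial : (polePolynomial ξ m).natDegree = ∑ k, m k := by
  rw [polePolynomial, Polynomial.natDegree_prod _ _ fun k _ =>
    pow_ne_zero _ (Polynomial.X_sub_C_ne_zero _)]
  simp

theorem eval_polePolynomial (z : ℂ) :
    (polePolynomial ξ m).eval z = ∏ k, (z - ξ k) ^ m k := by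
  simp [polePolynomial, Polynomial.eval_prod]

theorem eval_polePolynomial_ne_zero {z : ℂ} (hz : ∀ k, z ≠ ξ k) :
    (polePolynomial ξ m).eval z ≠ 0 := by
  rw [eval_polePolynomial]
  exact Finset.prod_ne_zero_iff.2 fun k _ => pow_ne_zero _ (sub_ne_zero.2 (hz k))

theorem eval_derivative_polePolynomial {z : ℂ} (hz : ∀ k, z ≠ ξ k) :
    (polePolynomial ξ m).derivative.eval z =
      fractionSum ξ m z * (polePolynomial ξ m).eval z := by
  have h : logDeriv (fun z => (polePolynomial ξ m).eval z) z = fractionSum ξ m z := by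
    simp only [eval_polePolynomial]
    have := logDeriv_prod (s := Finset.univ) (f := fun k z => (z - ξ k) ^ m k) (x := z)
      (fun k _ => pow_ne_zero _ (sub_ne_zero.2 (hz k))) (fun k _ => by fun_prop)
    rw [this]
    unfold fractionSum
    refine Finset.sum_congr rfl fun k _ => ?_
    rw [logDeriv_fun_pow (by fun_prop)]
    simp [logDeriv_apply, div_eq_mul_inv]
  rw [logDeriv_apply, Polynomial.deriv, div_eq_iff (eval_polePolynomial_ne_zero hz)] at h
  exact h

theorem eval_derivative_derivative_polePolynomial {z : ℂ} (hz : ∀ k, z ≠ ξ k) :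
    (polePolynomial ξ m).derivative.derivative.eval z =
      (fractionSumDeriv ξ m z + fractionSum ξ m z ^ 2) * (polePolynomial ξ m).eval z := by
  have hev : (fun w => (polePolynomial ξ m).derivative.eval w) =ᶠ[nhds z]
      fun w => fractionSum ξ m w * (polePolynomial ξ m).eval w := by
    have : ∀ᶠ w in nhds z, ∀ k, w ≠ ξ k :=
      Filter.eventually_all.2 fun k => isOpen_ne.mem_nhds (hz k)
    filter_upwards [this] with w hw using eval_derivative_polePolynomial hw
  have h1 := ((polePolynomial ξ m).derivative.hasDerivAt z).unique
    (((hasDerivAt_fractionSum hz).mul ((polePolynomial ξ m).hasDerivAt z)).congr_of_eventuallyEq hev)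
  rw [h1, eval_derivative_polePolynomial hz]
  ring

/-- The function `Φ` is a continuous argument of `Q` on the real line up to a constant, with
derivative `Im ρ`. Between `0` and `A / 2` it must change by at least `A² / 2 - A² / 4`, yet `|Φ| ≤
2n` because `|arctan| < 2`. -/
theorem sq_im_fractionSum_zero_le (hξ : ∀ k, (ξ k).im ≠ 0)
    (hlip : ∀ x : ℝ, ‖fractionSum ξ m x - fractionSum ξ m 0‖ ≤ |x|) :
    (fractionSum ξ m 0).im ^ 2 ≤ 16 * (∑ k, m k : ℕ) := by
  set A := (fractionSum ξ m 0).im with hA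
  set Φ : ℝ → ℝ := fun x => ∑ k, (m k : ℝ) * Real.arctan ((x - (ξ k).re) / (ξ k).im) with hΦ
  have hd : ∀ x : ℝ, HasDerivAt (fun x => Φ x - A * x) ((fractionSum ξ m x).im - A) x := by
    intro x
    have h1 : HasDerivAt Φ (fractionSum ξ m x).im x := by
      unfold fractionSum
      rw [Complex.im_sum]
      refine HasDerivAt.fun_sum fun k _ => ?_
      have h := (((((hasDerivAt_id x).sub_const (ξ k).re).div_const (ξ k).im)).arctan).const_mul
        (m k : ℝ)
      refine h.congr_deriv ?_
      have h2 := hξ k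
      have h3 : (x - (ξ k).re) ^ 2 + (ξ k).im ^ 2 ≠ 0 := by positivity
      have h4 : (ξ k).im ^ 2 + (x - (ξ k).re) ^ 2 ≠ 0 := by positivity
      rw [Complex.div_im]
      simp only [Complex.natCast_im, Complex.natCast_re, Complex.normSq_apply, Complex.sub_re,
        Complex.sub_im, Complex.ofReal_re, Complex.ofReal_im, id]
      have h5 : (x - (ξ k).re) * (x - (ξ k).re) + (0 - (ξ k).im) * (0 - (ξ k).im) ≠ 0 := by
        convert h3 using 1; ring
      field_simp
      ring
    exact (h1.sub ((hasDerivAt_id x).const_mul A)).congr_deriv (by simp)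
  have hb : ∀ x, |Φ x| ≤ (∑ k, m k : ℕ) * 2 := by
    intro x
    push_cast
    rw [Finset.sum_mul]
    refine (Finset.abs_sum_le_sum_abs _ _).trans (Finset.sum_le_sum fun k _ => ?_)
    rw [abs_mul, Nat.abs_cast]
    gcongr
    have h1 := Real.neg_pi_div_two_lt_arctan ((x - (ξ k).re) / (ξ k).im)
    have h2 := Real.arctan_lt_pi_div_two ((x - (ξ k).re) / (ξ k).im)
    rw [abs_le]
    constructor <;> linarith [Real.pi_lt_four]
  have h := abs_sub_le_sq_of_abs_deriv_le hd (fun x => by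
    rw [hA, ← Complex.sub_im]; exact (Complex.abs_im_le_norm _).trans (hlip x)) (A / 2)
  have h1 := abs_le.1 (hb (A / 2))
  have h2 := abs_le.1 (hb 0)
  have h3 := abs_le.1 h
  nlinarith

end PoleSums

theorem twelve_le_exp_three : (12 : ℝ) ≤ Real.exp 3 := by
  have : Real.exp 3 = Real.exp 1 ^ 3 := by rw [← Real.exp_nat_mul]; norm_num
  rw [this]
  calc (12 : ℝ) ≤ 2.7 ^ 3 := by norm_num
    _ ≤ _ := by gcongr; linarith [Real.exp_one_gt_d9]

/-! ### Size of `ρ(0)` and the inequality at a pole. -/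

section PoleSums

variable {ι : Type*} [Fintype ι] {ξ : ι → ℂ} {m : ι → ℕ}

theorem ofReal_ne_of_im_ne_zero {w : ℂ} (hw : w.im ≠ 0) (x : ℝ) : (x : ℂ) ≠ w := fun h =>
  hw (by rw [← h, Complex.ofReal_im])

theorem norm_fractionSum_sub_le (hξ : ∀ k, (ξ k).im ≠ 0)
    (hD : ∀ x : ℝ, ‖fractionSumDeriv ξ m x‖ ≤ 1) (x : ℝ) :
    ‖fractionSum ξ m x - fractionSum ξ m 0‖ ≤ |x| := by
  have h := convex_univ.norm_image_sub_le_of_norm_hasDerivWithin_le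
    (fun t _ => (hasDerivAt_fractionSum (m := m)
      fun k => ofReal_ne_of_im_ne_zero (hξ k) t).comp_ofReal.hasDerivWithinAt)
    (fun t _ => hD t) (Set.mem_univ 0) (Set.mem_univ x)
  simpa using h

theorem abs_log_norm_polePolynomial_le (hξ : ∀ k, (ξ k).im ≠ 0)
    (hlip : ∀ x : ℝ, ‖fractionSum ξ m x - fractionSum ξ m 0‖ ≤ |x|) (x : ℝ) :
    |Real.log ‖(polePolynomial ξ m).eval (x : ℂ)‖ - Real.log ‖(polePolynomial ξ m).eval 0‖ -
      (fractionSum ξ m 0).re * x| ≤ x ^ 2 := by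
  have hne := fun (x : ℝ) (k : ι) => ofReal_ne_of_im_ne_zero (hξ k) x
  have hd : ∀ x : ℝ, HasDerivAt (fun x : ℝ => Real.log ‖(polePolynomial ξ m).eval (x : ℂ)‖ -
      (fractionSum ξ m 0).re * x) ((fractionSum ξ m x).re - (fractionSum ξ m 0).re) x := by
    intro x
    have h1 : HasDerivAt (fun x : ℝ => (polePolynomial ξ m).eval (x : ℂ))
        (fractionSum ξ m x * (polePolynomial ξ m).eval (x : ℂ)) x := by
      rw [← eval_derivative_polePolynomial (hne x)]
      exact ((polePolynomial ξ m).hasDerivAt (x : ℂ)).comp_ofReal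
    exact ((hasDerivAt_log_norm h1 (eval_polePolynomial_ne_zero (hne x))).sub
      ((hasDerivAt_id x).const_mul _)).congr_deriv (by simp)
  have h := abs_sub_le_sq_of_abs_deriv_le hd (fun x => by
    rw [← Complex.sub_re]; exact (Complex.abs_re_le_norm _).trans (hlip x)) x
  convert h using 2
  simp; ring

/-- On the interval between `-A` and `0` one has `Ax + x² ≤ 0`, so `|Q| ≤ |Q(0)|` there. At `A / 2`,
on the other side of `0`, `log |Q|` has grown by at least `A² / 2 - A² / 4`, while the degree allows
at most `n log 12 ≤ 3n`. -/
theorem sq_re_fractionSum_zero_le (hξ : ∀ k, (ξ k).im ≠ 0) {n : ℕ} (hn : 1 ≤ n)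
    (hm : ∑ k, m k = n)
    (hlip : ∀ x : ℝ, ‖fractionSum ξ m x - fractionSum ξ m 0‖ ≤ |x|) :
    (fractionSum ξ m 0).re ^ 2 ≤ 16 * n := by
  set A := (fractionSum ξ m 0).re with hA
  set Q := polePolynomial ξ m with hQ
  have hlog := abs_log_norm_polePolynomial_le hξ hlip
  rw [← hA, ← hQ] at hlog
  have hpos : ∀ x : ℝ, 0 < ‖Q.eval (x : ℂ)‖ := fun x =>
    norm_pos_iff.2 (eval_polePolynomial_ne_zero fun k => ofReal_ne_of_im_ne_zero (hξ k) x)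
  have hpos0 : 0 < ‖Q.eval 0‖ := by simpa using hpos 0
  by_cases hA0 : A = 0
  · simp [hA0]
  have hle : ∀ x : ℝ, A * x + x ^ 2 ≤ 0 → ‖Q.eval (x : ℂ)‖ ≤ ‖Q.eval 0‖ := by
    intro x hx
    rw [← Real.log_le_log_iff (hpos x) hpos0]
    linarith [(abs_le.1 (hlog x)).2]
  have key : ‖Q.eval ((A / 2 : ℝ) : ℂ)‖ ≤ ‖Q.eval 0‖ * 12 ^ n := by
    have hdeg : Q.natDegree ≤ n := by rw [hQ, natDegree_polePolynomial, hm]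
    rcases lt_or_gt_of_ne hA0 with h | h
    · refine Polynomial.norm_eval_le_of_forall_mem_Icc hn hdeg (α := 0) (ℓ := -A) (by linarith)
        (fun x hx => hle x ?_) (fun x hx => ?_)
      · nlinarith [hx.1, hx.2]
      · rw [← Complex.ofReal_sub, Complex.norm_real, Real.norm_eq_abs, abs_le]
        constructor <;> linarith [hx.1, hx.2]
    · refine Polynomial.norm_eval_le_of_forall_mem_Icc hn hdeg (α := -A) (ℓ := A) (by linarith)
        (fun x hx => hle x ?_) (fun x hx => ?_)
      · nlinarith [hx.1, hx.2]
      · rw [← Complex.ofReal_sub, Complex.norm_real, Real.norm_eq_abs, abs_le]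
        constructor <;> linarith [hx.1, hx.2]
  have h1 := Real.log_le_log (hpos _) key
  rw [Real.log_mul hpos0.ne' (by positivity), Real.log_pow] at h1
  have h2 := (abs_le.1 (hlog (A / 2))).1
  have h3 : Real.log 12 ≤ 3 := by
    rw [Real.log_le_iff_le_exp (by norm_num)]
    exact twelve_le_exp_three
  have hn0 : (0 : ℝ) < n := by exact_mod_cast hn
  nlinarith

theorem norm_fractionSum_zero_le (hξ : ∀ k, (ξ k).im ≠ 0) {n : ℕ} (hn : 1 ≤ n)
    (hm : ∑ k, m k = n)
    (hlip : ∀ x : ℝ, ‖fractionSum ξ m x - fractionSum ξ m 0‖ ≤ |x|) :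
    ‖fractionSum ξ m 0‖ ≤ 8 * √n := by
  have h1 := sq_re_fractionSum_zero_le hξ hn hm hlip
  have h2 := sq_im_fractionSum_zero_le hξ hlip
  rw [hm] at h2
  have h3 : ‖fractionSum ξ m 0‖ ^ 2 ≤ (8 * √n) ^ 2 := by
    rw [← Complex.normSq_eq_norm_sq, Complex.normSq_apply, mul_pow, Real.sq_sqrt (by positivity)]
    have : (0 : ℝ) ≤ n := by positivity
    nlinarith
  exact (abs_le_of_sq_le_sq' h3 (by positivity)).2

open Polynomial in
/-- A pole `i y` on the imaginary axis cannot be too close to the origin. -/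
theorem one_le_sq_mul_exp_of_pole (hξ : ∀ k, (ξ k).im ≠ 0) {n : ℕ} (hn : 1 ≤ n)
    (hm : ∑ k, m k = n) (hmpos : ∀ k, 0 < m k)
    (hD : ∀ x : ℝ, ‖fractionSumDeriv ξ m x‖ ≤ 1) {y : ℝ} (hy : |y| ≤ √n) {k : ι}
    (hk : ξ k = y * Complex.I) : 1 ≤ y ^ 2 * Real.exp (42 * √n * |y|) := by
  have hlip := norm_fractionSum_sub_le hξ hD
  have hlog := abs_log_norm_polePolynomial_le hξ hlip
  have ha := norm_fractionSum_zero_le hξ hn hm hlip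
  have hne := fun (x : ℝ) (k : ι) => ofReal_ne_of_im_ne_zero (hξ k) x
  set a := fractionSum ξ m 0 with ha_def
  set Q := polePolynomial ξ m with hQ
  set R := √(n : ℝ) with hR
  have hRsq : R ^ 2 = n := Real.sq_sqrt (by positivity)
  have hR0 : 0 < R := Real.sqrt_pos.2 (by exact_mod_cast hn)
  have hpos : ∀ x : ℝ, 0 < ‖Q.eval (x : ℂ)‖ := fun x =>
    norm_pos_iff.2 (eval_polePolynomial_ne_zero (hne x))
  have hpos0 : 0 < ‖Q.eval 0‖ := by simpa using hpos 0
  -- With `F = Q e^{-az}`, `F' = P₁ e^{-az}` and `F'' = P₂ e^{-az}`: the derivatives stay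
  -- polynomials of degree at most `n` times the same exponential.
  set P₁ : ℂ[X] := derivative Q - C a * Q with hP₁
  set P₂ : ℂ[X] := derivative P₁ - C a * P₁ with hP₂
  have hdQ : Q.natDegree ≤ n := by rw [hQ, natDegree_polePolynomial, hm]
  have hdstep : ∀ P : ℂ[X], P.natDegree ≤ n → (derivative P - C a * P).natDegree ≤ n := by
    intro P hP
    refine (natDegree_sub_le _ _).trans (max_le ?_ ?_)
    · exact (natDegree_derivative_le P).trans (by omega)
    · exact (natDegree_C_mul_le _ _).trans hP
  have hdP₂ : P₂.natDegree ≤ n := hdstep _ (hdstep _ hdQ)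
  have hderiv : ∀ (P : ℂ[X]) (z : ℂ), HasDerivAt (fun z => P.eval z * Complex.exp (-a * z))
      ((derivative P - C a * P).eval z * Complex.exp (-a * z)) z := by
    intro P z
    have h := (P.hasDerivAt z).mul (((hasDerivAt_id z).const_mul (-a)).cexp)
    refine h.congr_deriv ?_
    simp; ring
  have hexp : ∀ z : ℂ, ‖z‖ ≤ R → ‖Complex.exp (-a * z)‖ ≤ Real.exp (8 * R ^ 2) := by
    intro z hz
    rw [Complex.norm_exp, Real.exp_le_exp]
    calc (-a * z).re ≤ ‖-a * z‖ := Complex.re_le_norm _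
      _ = ‖a‖ * ‖z‖ := by rw [norm_mul, norm_neg]
      _ ≤ (8 * R) * R := by gcongr
      _ = 8 * R ^ 2 := by ring
  have hreal : ∀ x : ℝ, ‖P₂.eval (x : ℂ) * Complex.exp (-a * x)‖ ≤
      ‖Q.eval 0‖ * Real.exp (2 * x ^ 2) := by
    intro x
    have h1 : P₂.eval (x : ℂ) = (fractionSumDeriv ξ m x + (fractionSum ξ m x - a) ^ 2) *
        Q.eval (x : ℂ) := by
      have e1 := eval_derivative_polePolynomial (m := m) (hne x)
      have e2 := eval_derivative_derivative_polePolynomial (m := m) (hne x)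
      rw [hP₂, hP₁]
      simp only [derivative_sub, derivative_mul, derivative_C, eval_sub, eval_mul, eval_C,
        zero_mul, zero_add]
      rw [e1, e2]
      ring
    have h2 : ‖fractionSumDeriv ξ m x + (fractionSum ξ m x - a) ^ 2‖ ≤ Real.exp (x ^ 2) := by
      refine (norm_add_le _ _).trans ?_
      rw [norm_pow]
      have : ‖fractionSum ξ m x - a‖ ^ 2 ≤ |x| ^ 2 := by gcongr; exact hlip x
      rw [sq_abs] at this
      linarith [hD x, Real.add_one_le_exp (x ^ 2)]
    have h3 : ‖Q.eval (x : ℂ)‖ * ‖Complex.exp (-a * x)‖ ≤ ‖Q.eval 0‖ * Real.exp (x ^ 2) := by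
      rw [Complex.norm_exp, ← Real.log_le_log_iff (by have := hpos x; positivity) (by positivity),
        Real.log_mul (hpos x).ne' (Real.exp_ne_zero _), Real.log_mul hpos0.ne' (Real.exp_ne_zero _),
        Real.log_exp, Real.log_exp]
      have := (abs_le.1 (hlog x)).2
      simp only [Complex.mul_re, Complex.neg_re, Complex.ofReal_re, Complex.neg_im,
        Complex.ofReal_im, mul_zero, sub_zero]
      linarith
    rw [h1, norm_mul, norm_mul, mul_assoc]
    calc _ ≤ Real.exp (x ^ 2) * (‖Q.eval 0‖ * Real.exp (x ^ 2)) := by gcongr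
      _ = _ := by
        rw [two_mul (x ^ 2), Real.exp_add]; ring
  have h12 : (12 : ℝ) ^ n ≤ Real.exp (3 * R ^ 2) := by
    rw [hRsq, mul_comm, Real.exp_nat_mul]
    gcongr
    exact twelve_le_exp_three
  -- `21 = (2 + 8) + 3 + 8`: the bound for `P₂` on `[-R, R]` after removing the exponential, then
  -- `12 ^ n ≤ e^{3R²}`, then the exponential again.
  have hdisc : ∀ z : ℂ, ‖z‖ ≤ R → ‖P₂.eval z * Complex.exp (-a * z)‖ ≤
      ‖Q.eval 0‖ * Real.exp (21 * R ^ 2) := by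
    intro z hz
    have hI : ∀ x ∈ Set.Icc (-R) (-R + 2 * R), |x| ≤ R := fun x hx =>
      abs_le.2 ⟨hx.1, by linarith [hx.2]⟩
    have h1 : ‖P₂.eval z‖ ≤ ‖Q.eval 0‖ * Real.exp (10 * R ^ 2) * 12 ^ n := by
      refine Polynomial.norm_eval_le_of_forall_mem_Icc hn hdP₂ (α := -R) (ℓ := 2 * R)
        (by linarith) (fun x hx => ?_) (fun x hx => ?_)
      · have hx' := hI x hx
        have hx2 : x ^ 2 ≤ R ^ 2 := by rw [← sq_abs]; gcongr
        calc ‖P₂.eval (x : ℂ)‖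
            = ‖P₂.eval (x : ℂ) * Complex.exp (-a * x)‖ * ‖Complex.exp (-a * (-x))‖ := by
              rw [← norm_mul, mul_assoc, ← Complex.exp_add]; simp
          _ ≤ ‖Q.eval 0‖ * Real.exp (2 * x ^ 2) * Real.exp (8 * R ^ 2) := by
              gcongr
              · exact hreal x
              · exact hexp _ (by simpa using hx')
          _ ≤ ‖Q.eval 0‖ * Real.exp (2 * R ^ 2) * Real.exp (8 * R ^ 2) := by gcongr
          _ = _ := by rw [mul_assoc, ← Real.exp_add]; ring_nf
      · calc ‖z - x‖ ≤ ‖z‖ + ‖(x : ℂ)‖ := norm_sub_le _ _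
          _ ≤ R + R := by
            gcongr; simpa using hI x hx
          _ ≤ 2 * (2 * R) := by linarith
    rw [norm_mul]
    calc _ ≤ ‖Q.eval 0‖ * Real.exp (10 * R ^ 2) * Real.exp (3 * R ^ 2) * Real.exp (8 * R ^ 2) := by
          gcongr
          · exact h1.trans (by gcongr)
          · exact hexp z hz
      _ = _ := by
          rw [mul_assoc, mul_assoc, ← Real.exp_add, ← Real.exp_add]; ring_nf
  -- `42 = 2B` with `B = 21`.
  set E := ‖Q.eval 0‖ * Real.exp (42 * R * |y|) with hE
  have hbound : ∀ t ∈ Set.Icc (-|y|) |y|,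
      ‖P₂.eval (t * Complex.I) * Complex.exp (-a * (t * Complex.I))‖ ≤ E := by
    intro t ht
    have ht' : |t| ≤ |y| := abs_le.2 ht
    have h := norm_mul_I_le_of_norm_le_on_disc
      (H := fun z => P₂.eval z * Complex.exp (-a * z))
      (fun z => (hderiv P₂ z).differentiableAt) (by norm_num) hpos0.le (fun x _ => hreal x) hdisc
      (ht'.trans hy)
    refine h.trans ?_
    rw [hE]
    norm_num
    gcongr
  have hmvt : ∀ (P : ℂ[X]) (c : ℝ), (∀ t ∈ Set.Icc (-|y|) |y|,
      ‖(derivative P - C a * P).eval (t * Complex.I) * Complex.exp (-a * (t * Complex.I))‖ ≤ c) →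
      ∀ t ∈ Set.Icc (-|y|) |y|,
      ‖P.eval (t * Complex.I) * Complex.exp (-a * (t * Complex.I)) - P.eval 0‖ ≤ c * |t| := by
    intro P c hc t ht
    have hlin : ∀ t : ℝ, HasDerivAt (fun t : ℝ => (t : ℂ) * Complex.I) Complex.I t := fun t => by
      simpa using ((hasDerivAt_id (t : ℂ)).mul_const Complex.I).comp_ofReal
    have h := (convex_Icc (-|y|) |y|).norm_image_sub_le_of_norm_hasDerivWithin_le
      (f := fun t : ℝ => P.eval (t * Complex.I) * Complex.exp (-a * (t * Complex.I)))
      (f' := fun t : ℝ => (derivative P - C a * P).eval (t * Complex.I) *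
        Complex.exp (-a * (t * Complex.I)) * Complex.I)
      (fun t _ => (HasDerivAt.comp (h₂ := fun z => P.eval z * Complex.exp (-a * z)) t
        (hderiv P (t * Complex.I)) (hlin t)).hasDerivWithinAt)
      (C := c) (fun t ht => by rw [norm_mul, Complex.norm_I, mul_one]; exact hc t ht)
      (x := 0) (y := t) (Set.mem_Icc.2 (by simp)) ht
    simpa using h
  -- This is `F'(0) = 0`, the reason for the choice of `a`; it makes the final factor `y²`.
  have hP₁0 : P₁.eval 0 = 0 := by
    have := eval_derivative_polePolynomial (m := m) (hne 0)
    rw [Complex.ofReal_zero] at this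
    rw [hP₁, eval_sub, eval_mul, eval_C, this, ← ha_def, sub_self]
  have hE0 : 0 ≤ E := by positivity
  have hone := hmvt P₁ E hbound
  have htwo := hmvt Q (E * |y|) (fun t ht => by
    have h := hone t ht
    rw [hP₁0, sub_zero] at h
    refine h.trans ?_
    exact mul_le_mul_of_nonneg_left (abs_le.2 ht) hE0) y (abs_le.1 le_rfl)
  have hQy : Q.eval (y * Complex.I) = 0 := by
    rw [hQ, eval_polePolynomial, ← hk]
    exact Finset.prod_eq_zero (Finset.mem_univ k) (by simp [(hmpos k).ne'])
  rw [hQy, zero_mul, zero_sub, norm_neg, mul_assoc, ← pow_two, sq_abs] at htwo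
  refine le_of_mul_le_mul_left ?_ hpos0
  linarith [htwo]

end PoleSums

/-! ### Solving the inequality for `|y|`. -/

/-- With `s = √(ln n)`, a smaller `|y|` would give `42² n ≤ s² e^s ≤ 2 e^{2s}`, whereas `2s ≤ 1 +
s²` gives `e^{2s} ≤ e n ≤ 3n`. -/
theorem le_of_one_le_sq_mul_exp {n : ℕ} (hn : 1 ≤ n) {y : ℝ}
    (h : |y| ≤ √n → 1 ≤ y ^ 2 * Real.exp (42 * √n * |y|)) :
    1 / 42 * √(Real.log n / n) ≤ |y| := by
  by_contra! hlt
  have hn0 : (0 : ℝ) < n := by exact_mod_cast hn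
  have hn1 : (1 : ℝ) ≤ n := by exact_mod_cast hn
  have hlog : 0 ≤ Real.log n := Real.log_nonneg hn1
  set s := √(Real.log n) with hs
  have hs0 : 0 ≤ s := Real.sqrt_nonneg _
  have hs2 : s ^ 2 = Real.log n := Real.sq_sqrt hlog
  have hr0 : 0 < √(n : ℝ) := Real.sqrt_pos.2 hn0
  have hr2 : √(n : ℝ) ^ 2 = n := Real.sq_sqrt hn0.le
  rw [Real.sqrt_div hlog, ← hs] at hlt
  have hlt' : 42 * √n * |y| ≤ s := by
    have : 42 * √n * |y| ≤ 42 * √n * (1 / 42 * (s / √n)) := by gcongr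
    refine this.trans (le_of_eq ?_)
    field_simp
  have hsr : s ≤ √n := Real.sqrt_le_sqrt ((Real.log_le_sub_one_of_pos hn0).trans (by linarith))
  have hr1 : 1 ≤ √(n : ℝ) := Real.one_le_sqrt.2 hn1
  have hy : |y| ≤ √n := by nlinarith [abs_nonneg y]
  have h1 := h hy
  have h2 : (n : ℝ) = Real.exp (s ^ 2) := by rw [hs2, Real.exp_log hn0]
  have h3 : 42 ^ 2 * n * y ^ 2 ≤ s ^ 2 := by
    have : (42 * √n * |y|) ^ 2 ≤ s ^ 2 := by gcongr
    rw [mul_pow, mul_pow, hr2, sq_abs] at this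
    exact this
  have h4 : s ^ 2 ≤ Real.exp s * 2 := by
    have := Real.quadratic_le_exp_of_nonneg hs0
    nlinarith
  have h5 : Real.exp (42 * √n * |y|) ≤ Real.exp s := Real.exp_le_exp.2 hlt'
  have h6 : Real.exp s * Real.exp s ≤ 3 * n := by
    rw [← Real.exp_add]
    calc Real.exp (s + s) ≤ Real.exp (1 + s ^ 2) := Real.exp_le_exp.2 (by nlinarith [sq_nonneg (s - 1)])
      _ = Real.exp 1 * n := by rw [Real.exp_add, h2]
      _ ≤ 3 * n := by gcongr; linarith [Real.exp_one_lt_d9]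
  have h7 : 42 ^ 2 * n * 1 ≤ 42 ^ 2 * n * (y ^ 2 * Real.exp (42 * √n * |y|)) := by gcongr
  have h8 : 42 ^ 2 * n * (y ^ 2 * Real.exp (42 * √n * |y|)) ≤ Real.exp s * 2 * Real.exp s := by
    rw [← mul_assoc]
    exact mul_le_mul (h3.trans h4) h5 (Real.exp_pos _).le (by positivity)
  nlinarith

/-! ### From the essential supremum to the poles. -/

namespace SimplePartialFraction

variable {n : ℕ} (ρ : SimplePartialFraction n)

theorem deriv_eval {z : ℂ} (hz : ∀ k, z ≠ ρ.pole k) :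
    deriv ρ.eval z = fractionSumDeriv ρ.pole ρ.mult z :=
  (hasDerivAt_fractionSum hz).deriv

theorem continuousAt_fractionSumDeriv {z : ℂ} (hz : ∀ k, z ≠ ρ.pole k) :
    ContinuousAt (fractionSumDeriv ρ.pole ρ.mult) z := by
  unfold fractionSumDeriv
  refine (tendsto_finsetSum _ fun k _ => ?_).neg
  exact continuousAt_const.div (by fun_prop) (pow_ne_zero _ (sub_ne_zero.2 (hz k)))

theorem finite_setOf_eq_pole : {x : ℝ | ∃ k, (x : ℂ) = ρ.pole k}.Finite := by
  have : {x : ℝ | ∃ k, (x : ℂ) = ρ.pole k} ⊆ Set.range fun k => (ρ.pole k).re := by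
    rintro x ⟨k, hk⟩
    exact ⟨k, by simp [← hk]⟩
  exact (Set.finite_range _).subset this

theorem isOpen_setOf_forall_ne_pole : IsOpen {x : ℝ | ∀ k, (x : ℂ) ≠ ρ.pole k} := by
  have := ρ.finite_setOf_eq_pole.isClosed.isOpen_compl
  convert this using 1
  ext x; simp

/-- The norm controls `ρ'` only almost everywhere; continuity off the poles makes the bound
pointwise, since a violation would persist on a set of positive measure. -/
theorem norm_fractionSumDeriv_le (h : ρ.derivNorm ∞ ≤ 1) {x : ℝ} (hx : ∀ k, (x : ℂ) ≠ ρ.pole k) :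
    ‖fractionSumDeriv ρ.pole ρ.mult x‖ ≤ 1 := by
  have hae : ∀ᵐ t : ℝ, ‖deriv ρ.eval (t : ℂ)‖ ≤ 1 := by
    rw [derivNorm, eLpNorm_exponent_top] at h
    filter_upwards [ae_le_eLpNormEssSup (f := fun t : ℝ => deriv ρ.eval (t : ℂ))
      (μ := volume)] with t ht
    have := ht.trans h
    rwa [← ofReal_norm, ENNReal.ofReal_le_one] at this
  by_contra! hlt
  have hc : ContinuousAt (fun t : ℝ => ‖fractionSumDeriv ρ.pole ρ.mult t‖) x :=
    ((ρ.continuousAt_fractionSumDeriv hx).comp Complex.continuous_ofReal.continuousAt).norm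
  have hev : ∀ᶠ t : ℝ in nhds x, 1 < ‖deriv ρ.eval (t : ℂ)‖ := by
    filter_upwards [hc.eventually_const_lt hlt,
      ρ.isOpen_setOf_forall_ne_pole.mem_nhds hx] with t h1 h2
    rwa [ρ.deriv_eval h2]
  have hpos := Measure.measure_pos_of_mem_nhds volume hev
  refine hpos.ne' (measure_mono_null ?_ (ae_iff.1 hae))
  intro t ht
  exact not_le.2 ht

/-- Near a real pole `x₀` the term `mult j / (x - x₀)²` dominates `ρ'`. Multiplying by `(x - x₀)²`
and letting `x → x₀` would give `mult j ≤ 0`. -/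
theorem pole_im_ne_zero (h : ρ.derivNorm ∞ ≤ 1) (j : Fin ρ.numPoles) : (ρ.pole j).im ≠ 0 := by
  intro hj
  set x₀ : ℝ := (ρ.pole j).re with hx₀
  have hpj : ρ.pole j = x₀ := Complex.ext (by simp [hx₀]) (by simp [hj])
  set g : ℝ → ℂ := fun x => ∑ k ∈ Finset.univ.erase j,
    (ρ.mult k : ℂ) / ((x : ℂ) - ρ.pole k) ^ 2 * ((x : ℂ) - x₀) ^ 2 with hg
  have hgc : ContinuousAt g x₀ := by
    refine tendsto_finsetSum _ fun k hk => ?_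
    have hne : (x₀ : ℂ) - ρ.pole k ≠ 0 := by
      rw [← hpj, sub_ne_zero]
      exact fun hk' => (Finset.ne_of_mem_erase hk) (ρ.pole_injective hk').symm
    have : ContinuousAt (fun x : ℝ => (ρ.mult k : ℂ) / ((x : ℂ) - ρ.pole k) ^ 2) x₀ :=
      continuousAt_const.div (by fun_prop) (pow_ne_zero _ hne)
    exact this.mul (f := fun x : ℝ => _) (g := fun x : ℝ => ((x : ℂ) - x₀) ^ 2) (by fun_prop)
  have hg0 : g x₀ = 0 := by simp [hg]
  have hev : ∀ᶠ x : ℝ in nhdsWithin x₀ {x₀}ᶜ, (ρ.mult j : ℝ) - ‖g x‖ ≤ (x - x₀) ^ 2 := by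
    have hnp : ∀ᶠ x : ℝ in nhdsWithin x₀ {x₀}ᶜ, ∀ k, (x : ℂ) ≠ ρ.pole k := by
      have hfin := ρ.finite_setOf_eq_pole.subset (Set.sdiff_subset (t := {x₀}))
      have : ∀ᶠ x : ℝ in nhds x₀, x ∉ {x : ℝ | ∃ k, (x : ℂ) = ρ.pole k} \ {x₀} :=
        hfin.isClosed.isOpen_compl.mem_nhds (by simp)
      filter_upwards [nhdsWithin_le_nhds this, self_mem_nhdsWithin] with x h1 h2 k hk
      exact h1 ⟨⟨k, hk⟩, h2⟩
    filter_upwards [hnp] with x hx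
    have hD := ρ.norm_fractionSumDeriv_le h hx
    have hne : (x : ℂ) - x₀ ≠ 0 := by rw [← hpj]; exact sub_ne_zero.2 (hx j)
    have heq : (ρ.mult j : ℂ) = -(fractionSumDeriv ρ.pole ρ.mult x * ((x : ℂ) - x₀) ^ 2) - g x := by
      rw [fractionSumDeriv, neg_mul, neg_neg, ← Finset.add_sum_erase _ _ (Finset.mem_univ j),
        add_mul, Finset.sum_mul, hg, hpj]
      simp only [add_sub_cancel_right]
      field_simp
    have hn := norm_sub_le (-(fractionSumDeriv ρ.pole ρ.mult x * ((x : ℂ) - x₀) ^ 2)) (g x)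
    rw [← heq, norm_neg, norm_mul, norm_pow, ← Complex.ofReal_sub, Complex.norm_real,
      Real.norm_eq_abs, sq_abs, Complex.norm_natCast] at hn
    nlinarith [sq_nonneg (x - x₀)]
  have hle : (ρ.mult j : ℝ) - ‖g x₀‖ ≤ (x₀ - x₀) ^ 2 := by
    refine le_of_tendsto_of_tendsto (b := nhdsWithin x₀ {x₀}ᶜ) ?_ ?_ hev
    · exact (continuousAt_const.sub hgc.norm).tendsto.mono_left nhdsWithin_le_nhds
    · exact (by fun_prop : ContinuousAt (fun x : ℝ => (x - x₀) ^ 2) x₀).tendsto.mono_left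
        nhdsWithin_le_nhds
  rw [hg0, norm_zero, sub_self] at hle
  have : (1 : ℝ) ≤ ρ.mult j := by exact_mod_cast ρ.mult_pos j
  linarith

theorem le_abs_im_pole (hn : 1 ≤ n) (h : ρ.derivNorm ∞ ≤ 1) (j : Fin ρ.numPoles) :
    1 / 42 * √(Real.log n / n) ≤ |(ρ.pole j).im| := by
  have him := ρ.pole_im_ne_zero h
  refine le_of_one_le_sq_mul_exp hn fun hy => ?_
  -- A real translation puts the pole on the imaginary axis and preserves the bound on `ρ'`.
  refine one_le_sq_mul_exp_of_pole (ξ := fun k => ρ.pole k - (ρ.pole j).re) (m := ρ.mult) (k := j)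
    (fun k => by simpa using him k) hn ρ.sum_mult ρ.mult_pos (fun x => ?_) hy ?_
  · have := ρ.norm_fractionSumDeriv_le h (x := x + (ρ.pole j).re)
      (fun k => ofReal_ne_of_im_ne_zero (him k) _)
    convert this using 2
    unfold fractionSumDeriv
    congr 1
    refine Finset.sum_congr rfl fun k _ => ?_
    push_cast
    ring_nf
  · apply Complex.ext <;> simp

/-- Needed because `sInf ∅ = 0` in `ℝ`. For an `n`-fold pole at `ni`, `|ρ'| ≤ n / n² ≤ 1`. -/
theorem exists_derivNorm_le_one (hn : 1 ≤ n) : ∃ ρ : SimplePartialFraction n, ρ.derivNorm ∞ ≤ 1 := by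
  let ρ : SimplePartialFraction n :=
    { numPoles := 1
      pole := fun _ => n * Complex.I
      mult := fun _ => n
      pole_injective := fun _ _ _ => Subsingleton.elim _ _
      mult_pos := fun _ => hn
      sum_mult := by simp }
  refine ⟨ρ, ?_⟩
  have hn1 : (1 : ℝ) ≤ n := by exact_mod_cast hn
  have hn0 : (0 : ℝ) < n := by linarith
  rw [derivNorm, eLpNorm_exponent_top]
  refine (eLpNormEssSup_le_of_ae_bound (C := 1) (Filter.Eventually.of_forall fun x => ?_)).trans
    (by simp)
  rw [ρ.deriv_eval fun k => ofReal_ne_of_im_ne_zero (by simp [ρ]; omega) x]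
  have hnorm : (n : ℝ) ≤ ‖(x : ℂ) - n * Complex.I‖ := by
    have := Complex.abs_im_le_norm ((x : ℂ) - n * Complex.I)
    simpa using this
  have : fractionSumDeriv ρ.pole ρ.mult x = -((n : ℂ) / ((x : ℂ) - n * Complex.I) ^ 2) := by
    simp [fractionSumDeriv, ρ]
  rw [this, norm_neg, norm_div, norm_pow, Complex.norm_natCast, div_le_one (pow_pos (hn0.trans_le hnorm) 2)]
  nlinarith

end SimplePartialFraction

theorem theorem2 :
    ∃ c : ℝ, 0 < c ∧ ∃ n₀ : ℕ, ∀ n : ℕ, n₀ ≤ n →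
      c * √(Real.log n / n) ≤ gelfondInf n ∞ ∧
      ∀ ρ : SimplePartialFraction n, ρ.derivNorm ∞ ≤ 1 →
        ∀ k, c * √(Real.log n / n) ≤ |(ρ.pole k).im| := by
  refine ⟨1 / 42, by norm_num, 1, fun n hn => ⟨?_, fun ρ hρ k => ρ.le_abs_im_pole hn hρ k⟩⟩
  obtain ⟨ρ₀, h₀⟩ := SimplePartialFraction.exists_derivNorm_le_one hn
  refine le_csInf ⟨_, ρ₀, h₀, rfl⟩ ?_
  rintro _ ⟨ρ, hρ, rfl⟩
  -- Without poles the infimum `minAbsIm` would default to `0`; `n ≥ 1` excludes this.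
  have : Nonempty (Fin ρ.numPoles) := by
    by_contra hemp
    rw [not_nonempty_iff] at hemp
    have := ρ.sum_mult
    simp at this
    omega
  exact le_ciInf fun k => ρ.le_abs_im_pole hn hρ k
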